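/- Let $\delta>2$ be an integer and let $E$ be a finite set. A family $\mathcal G$ of subsets of $E$ is called a $G_\delta$-family if (1) $\{e\}\in\mathcal G$ for every $e\in E$; (2) for all $G,H\in\mathcal G$ with $G\cap H\neq\emptyset$ and $G\cup H\neq E$, both $G\cap H$ and $G\cup H$ belong to $\mathcal G$; (3) $|E|=\frac{\delta g_0}{\delta-1}$ for some integer $g_0\equiv 0 \pmod{\delta-1}$; (4) for every $G_i\in\mathcal G$, $|G_i|=\frac{\delta g_i-1}{\delta-1}$ for some integer $g_i\equiv 1\pmod{\delta-1}$. For a $G_\delta$-family $\mathcal G$, let $\tilde{\mathcal G}$ be the family of all nonempty sets that are intersections in $E$ of finitely many sets from $\mathcal G$ (the intersection of zero sets being $E$). For $F\in\tilde{\mathcal G}$ let $c(F)$ be the least $k\ge 0$ such that $F$ is the intersection in $E$ of $k$ sets from $\mathcal G$, and put $r(F)=\frac1\delta\big((\delta-1)|F|+c(F)\big)$. Let $\mathfrak C_{\mathcal G}$ be the family of inclusion-minimal sets among all $(r(F)+1)$-element subsets of $F$, over all $F\in\tilde{\mathcal G}$. A matroid is connected if every two distinct elements of its ground set lie in a common circuit.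 A good flat of a matroid $M$ on $E$ is a flat $\emptyset\neq G\subsetneq E$ such that both the restriction $M|_G$ and the contraction $M/G$ are connected. Theorem. Suppose $\mathcal G$ is a $G_\delta$-family on $E$ for some $\delta>2$. Then $\mathfrak C_{\mathcal G}$ is the set of circuits of a (unique) matroid $M_{\mathcal G}$ on the ground set $E$. The matroid $M_{\mathcal G}$ is connected, its set of good flats is equal to $\mathcal G$, every $G_i\in\mathcal G$ has rank $g_i$ in $M_{\mathcal G}$, and the ground set $E$ has rank $g_0$. -/

import Mathlib

namespace GMatroid

variable {α : Type*}

/-- `𝒢` is a `G_δ`-family on the finite ground set `E` (the conditions are used for `2 ≤ δ`).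
The equations for the cardinalities are written without denominators. -/
structure IsGFamily (δ : ℕ) (E : Set α) (𝒢 : Set (Set α)) : Prop where
  finite_ground : E.Finite
  subset_ground : ∀ G ∈ 𝒢, G ⊆ E
  singleton_mem : ∀ e ∈ E, {e} ∈ 𝒢
  inter_mem : ∀ G ∈ 𝒢, ∀ H ∈ 𝒢, (G ∩ H).Nonempty → G ∪ H ≠ E → G ∩ H ∈ 𝒢
  union_mem : ∀ G ∈ 𝒢, ∀ H ∈ 𝒢, (G ∩ H).Nonempty → G ∪ H ≠ E → G ∪ H ∈ 𝒢
  card_ground : ∃ g₀ : ℤ, g₀ ≡ 0 [ZMOD (δ : ℤ) - 1] ∧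
    ((δ : ℤ) - 1) * (E.ncard : ℤ) = (δ : ℤ) * g₀
  card_mem : ∀ G ∈ 𝒢, ∃ g : ℤ, g ≡ 1 [ZMOD (δ : ℤ) - 1] ∧
    ((δ : ℤ) - 1) * (G.ncard : ℤ) = (δ : ℤ) * g - 1

/-- `F` is the intersection in `E` of `k` sets from `𝒢`; for `k = 0` this is `E` itself. -/
def IsInterOf (E : Set α) (𝒢 : Set (Set α)) (k : ℕ) (F : Set α) : Prop :=
  ∃ G : Fin k → Set α, (∀ i, G i ∈ 𝒢) ∧ F = E ∩ ⋂ i, G i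

/-- The family `𝒢̃` of nonempty intersections of sets from `𝒢`. -/
def interClosure (E : Set α) (𝒢 : Set (Set α)) : Set (Set α) :=
  {F | F.Nonempty ∧ ∃ k, IsInterOf E 𝒢 k F}

/-- `c(F)`: the least `k` such that `F` is the intersection in `E` of `k` sets from `𝒢`. -/
noncomputable def interCount (E : Set α) (𝒢 : Set (Set α)) (F : Set α) : ℕ :=
  sInf {k | IsInterOf E 𝒢 k F}

/-- The number `r(F) = ((δ - 1)|F| + c(F)) / δ`, taken in `ℚ`. -/
noncomputable def weight (δ : ℕ) (E : Set α) (𝒢 : Set (Set α)) (F : Set α) : ℚ :=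
  (((δ : ℚ) - 1) * (F.ncard : ℚ) + (interCount E 𝒢 F : ℚ)) / (δ : ℚ)

/-- `C` is an `(r(F) + 1)`-element subset of `F` for some `F ∈ 𝒢̃`. -/
def IsPreCircuit (δ : ℕ) (E : Set α) (𝒢 : Set (Set α)) (C : Set α) : Prop :=
  ∃ F ∈ interClosure E 𝒢, C ⊆ F ∧ (C.ncard : ℚ) = weight δ E 𝒢 F + 1

/-- The family of inclusion-minimal sets among all `(r(F) + 1)`-element subsets of `F`
over all `F ∈ 𝒢̃`. -/
def circuits (δ : ℕ) (E : Set α) (𝒢 : Set (Set α)) : Set (Set α) :=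
  {C | Minimal (IsPreCircuit δ E 𝒢) C}

/-- `M` is the matroid `M_𝒢` on `E` with the set of circuits `circuits δ E 𝒢`. -/
def IsGMatroid (δ : ℕ) (E : Set α) (𝒢 : Set (Set α)) (M : Matroid α) : Prop :=
  M.E = E ∧ {C | M.IsCircuit C} = circuits δ E 𝒢

/-- A matroid is connected if every two distinct elements of its ground set lie in a common circuit. -/
def IsConnected (M : Matroid α) : Prop :=
  ∀ e ∈ M.E, ∀ f ∈ M.E, e ≠ f → ∃ C, M.IsCircuit C ∧ e ∈ C ∧ f ∈ C

/-- A good flat: a nonempty proper flat whose restriction and contraction are connected. -/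
structure IsGoodFlat (M : Matroid α) (G : Set α) : Prop where
  isFlat : M.IsFlat G
  nonempty : G.Nonempty
  ne_ground : G ≠ M.E
  restrict_connected : IsConnected (M.restrict G)
  contract_connected : IsConnected (M.contract G)

end GMatroid

namespace GMatroid

open Set

section

variable {α : Type*} {M : Matroid α}

/-- The rank of a set as a natural number. -/
noncomputable def natRk (M : Matroid α) (S : Set α) : ℕ := (M.eRk S).toNat

theorem natRk_cast [M.Finite] (S : Set α) : (natRk M S : ℕ∞) = M.eRk S :=
  ENat.natCast_toNat (by rw [Matroid.eRk_ne_top_iff]; exact M.isRkFinite_set S)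

theorem ncard_eq_natRk {I S : Set α} (hI : M.IsBasis I S) : I.ncard = natRk M S := by
  rw [natRk, ← hI.encard_eq_eRk]; rfl

theorem natRk_mono [M.Finite] {S T : Set α} (h : S ⊆ T) : natRk M S ≤ natRk M T := by
  have := M.eRk_mono h
  rw [← natRk_cast, ← natRk_cast] at this
  exact_mod_cast this

theorem natRk_restrict {S A : Set α} (h : A ⊆ S) : natRk (M.restrict S) A = natRk M A := by
  rw [natRk, natRk, Matroid.restrict_eRk_eq _ h]

theorem natRk_contract [M.Finite] {S X : Set α} (hS : S ⊆ M.E) (hX : X ⊆ M.E)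
    (hd : Disjoint X S) : natRk (M.contract S) X + natRk M S = natRk M (X ∪ S) := by
  obtain ⟨I, J, hI, hJ, hIJ⟩ := M.exists_isBasis_subset_isBasis
    (subset_union_right : S ⊆ X ∪ S) (union_subset hX hS)
  have h := hI.contract_sdiff_isBasis_sdiff hJ hIJ
  have h' : (M.contract S).IsBasis (J \ I) ((X ∪ S) \ S) := by
    rw [hI.contract_eq_contract_delete]
    exact h.delete (disjoint_sdiff_left.mono_right sdiff_subset)
  rw [union_sdiff_cancel_right (by rw [hd.inter_eq])] at h'
  rw [← ncard_eq_natRk h', ← ncard_eq_natRk hI, ← ncard_eq_natRk hJ]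
  exact ncard_sdiff_add_ncard_of_subset hIJ (M.set_finite J hJ.indep.subset_ground)

/-- Being contained in a common circuit is a transitive relation. -/
theorem exists_isCircuit_mem_mem [M.Finite] {C₁ C₂ : Set α} {e g : α} (h₁ : M.IsCircuit C₁)
    (h₂ : M.IsCircuit C₂) (he : e ∈ C₁) (hg : g ∈ C₂) (hne : (C₁ ∩ C₂).Nonempty) :
    ∃ C, M.IsCircuit C ∧ e ∈ C ∧ g ∈ C := by
  induction hn : (C₁ ∪ C₂).ncard using Nat.strong_induction_on generalizing C₁ C₂ with
  | _ n ih =>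
  by_contra hno
  push Not at hno
  have hfin : (C₁ ∪ C₂).Finite :=
    M.set_finite _ (union_subset h₁.subset_ground h₂.subset_ground)
  obtain ⟨f, hf₁, hf₂⟩ := hne
  have hg₁ : g ∉ C₁ := hno _ h₁ he
  have he₂ : e ∉ C₂ := fun h => hno _ h₂ h hg
  obtain ⟨C₃, h₃s, h₃, he₃⟩ := h₁.strong_elimination h₂ hf₁ hf₂ he he₂
  obtain ⟨C₄, h₄s, h₄, hg₄⟩ := h₂.strong_elimination h₁ hf₂ hf₁ hg hg₁
  rw [union_comm] at h₄s
  have hsub {C : Set α} (hC : C ⊆ (C₁ ∪ C₂) \ {f}) : C ⊆ C₁ ∪ C₂ := hC.trans sdiff_subset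
  have hf {C : Set α} (hC : C ⊆ (C₁ ∪ C₂) \ {f}) : f ∉ C := fun h => (hC h).2 rfl
  have key₃ : (C₃ ∩ C₂).Nonempty := by
    by_contra hemp
    have hss : C₃ ⊆ C₁ := fun x hx => (hsub h₃s hx).elim id
      (fun h => (hemp ⟨x, hx, h⟩).elim)
    rw [h₃.eq_of_subset_isCircuit h₁ hss] at h₃s
    exact hf h₃s hf₁
  have key₄ : (C₁ ∩ C₄).Nonempty := by
    by_contra hemp
    have hss : C₄ ⊆ C₂ := fun x hx => (hsub h₄s hx).elim
      (fun h => (hemp ⟨x, h, hx⟩).elim) id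
    rw [h₄.eq_of_subset_isCircuit h₂ hss] at h₄s
    exact hf h₄s hf₂
  have aux {D₁ D₂ : Set α} (hD₁ : M.IsCircuit D₁) (hD₂ : M.IsCircuit D₂) (heD : e ∈ D₁)
      (hgD : g ∈ D₂) (hD : (D₁ ∩ D₂).Nonempty) (hs : D₁ ∪ D₂ ⊆ C₁ ∪ C₂) :
      D₁ ∪ D₂ = C₁ ∪ C₂ := by
    by_contra hneq
    obtain ⟨C, hC, heC, hgC⟩ := ih _ (hn ▸ ncard_lt_ncard (hs.ssubset_of_ne hneq) hfin)
      hD₁ hD₂ heD hgD hD rfl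
    exact hno C hC heC hgC
  have e₃ := aux h₃ h₂ he₃ hg key₃ (union_subset (hsub h₃s) subset_union_right)
  have e₄ := aux h₁ h₄ he hg₄ key₄ (union_subset subset_union_left (hsub h₄s))
  obtain ⟨x, hx₃, hx₂⟩ := key₃
  have hx₁ : g ∈ C₃ ∨ (C₃ ∩ C₄).Nonempty := by
    by_cases hx : x ∈ C₁
    · by_cases hss : C₃ ⊆ C₁
      · rw [h₃.eq_of_subset_isCircuit h₁ hss] at h₃s
        exact (hf h₃s hf₁).elim
      · obtain ⟨y, hy, hy₁⟩ := not_subset.1 hss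
        have : y ∈ C₁ ∪ C₄ := e₄ ▸ hsub h₃s hy
        exact Or.inr ⟨y, hy, this.resolve_left hy₁⟩
    · have : x ∈ C₁ ∪ C₄ := e₄ ▸ Or.inr hx₂
      exact Or.inr ⟨x, hx₃, this.resolve_left hx⟩
  rcases hx₁ with h | h
  · exact hno _ h₃ he₃ h
  · have e₅ := aux h₃ h₄ he₃ hg₄ h (union_subset (hsub h₃s) (hsub h₄s))
    have : f ∈ C₃ ∪ C₄ := e₅ ▸ Or.inl hf₁
    exact this.elim (hf h₃s) (hf h₄s)

theorem natRk_add_natRk_le_of_no_crossing [M.Finite] {A B : Set α} (hd : Disjoint A B)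
    (hAB : A ∪ B = M.E) (h : ∀ C, M.IsCircuit C → C ⊆ A ∨ C ⊆ B) :
    natRk M A + natRk M B ≤ natRk M M.E := by
  obtain ⟨I, hI⟩ := M.exists_isBasis A (hAB ▸ subset_union_left)
  obtain ⟨J, hJ⟩ := M.exists_isBasis B (hAB ▸ subset_union_right)
  have hIJE : I ∪ J ⊆ M.E := union_subset hI.indep.subset_ground hJ.indep.subset_ground
  have hIJ : M.Indep (I ∪ J) := by
    by_contra hdep
    obtain ⟨C, hC, hCc⟩ := (Matroid.dep_of_not_indep hdep hIJE).exists_isCircuit_subset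
    rcases h C hCc with hs | hs
    · refine hCc.not_indep (hI.indep.subset fun x hx => ?_)
      exact (hC hx).elim id fun hxJ => (hd.ne_of_mem (hs hx) (hJ.subset hxJ) rfl).elim
    · refine hCc.not_indep (hJ.indep.subset fun x hx => ?_)
      exact (hC hx).elim (fun hxI => (hd.ne_of_mem (hI.subset hxI) (hs hx) rfl).elim) id
  rw [← ncard_eq_natRk hI, ← ncard_eq_natRk hJ,
    ← ncard_union_eq (hd.mono hI.subset hJ.subset)
      (M.set_finite _ hI.indep.subset_ground) (M.set_finite _ hJ.indep.subset_ground),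
    ncard_eq_natRk hIJ.isBasis_self]
  exact natRk_mono hIJE

theorem isConnected_of_lt [M.Finite] (h : ∀ A B : Set α, A.Nonempty → B.Nonempty → Disjoint A B →
    A ∪ B = M.E → natRk M M.E < natRk M A + natRk M B) : IsConnected M := by
  intro e he f hf hef
  by_contra hno
  push Not at hno
  let K : Set α := {x | x = e ∨ ∃ C, M.IsCircuit C ∧ e ∈ C ∧ x ∈ C}
  have hKE : K ⊆ M.E := by
    rintro x (rfl | ⟨C, hC, -, hx⟩)
    exacts [he, hC.subset_ground hx]
  refine (h K (M.E \ K) ⟨e, Or.inl rfl⟩ ⟨f, hf, ?_⟩ disjoint_sdiff_right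
    (union_sdiff_cancel hKE)).not_ge
    (natRk_add_natRk_le_of_no_crossing disjoint_sdiff_right (union_sdiff_cancel hKE) ?_)
  · rintro (rfl | ⟨C, hC, heC, hfC⟩)
    exacts [hef rfl, hno C hC heC hfC]
  · intro C hC
    by_cases hCK : (C ∩ K).Nonempty
    · left
      obtain ⟨x, hxC, rfl | ⟨D, hD, heD, hxD⟩⟩ := hCK
      · exact fun y hy => Or.inr ⟨C, hC, hxC, hy⟩
      · exact fun y hy => Or.inr (exists_isCircuit_mem_mem hD hC heD hy ⟨x, hxD, hxC⟩)
    · right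
      exact fun y hy => ⟨hC.subset_ground hy, fun hyK => hCK ⟨y, hy, hyK⟩⟩

theorem IsConnected.lt [M.Finite] (hM : IsConnected M) {A B : Set α} (hA : A.Nonempty)
    (hB : B.Nonempty) (hd : Disjoint A B) (hAB : A ∪ B = M.E) :
    natRk M M.E < natRk M A + natRk M B := by
  by_contra hle
  rw [not_lt] at hle
  obtain ⟨e, he⟩ := hA
  obtain ⟨f, hf⟩ := hB
  have hAE : A ⊆ M.E := hAB ▸ subset_union_left
  have hBE : B ⊆ M.E := hAB ▸ subset_union_right
  obtain ⟨C, hC, heC, hfC⟩ := hM e (hAE he) f (hBE hf) (hd.ne_of_mem he hf)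
  have hCA : M.Indep (C ∩ A) := hC.ssubset_indep
    (inter_subset_left.ssubset_of_mem_notMem hfC fun h => hd.ne_of_mem h.2 hf rfl)
  have hCB : M.Indep (C ∩ B) := hC.ssubset_indep
    (inter_subset_left.ssubset_of_mem_notMem heC fun h => hd.ne_of_mem he h.2 rfl)
  obtain ⟨I, hI, hCI⟩ := hCA.subset_isBasis_of_subset inter_subset_right hAE
  obtain ⟨J, hJ, hCJ⟩ := hCB.subset_isBasis_of_subset inter_subset_right hBE
  have hIf := M.set_finite _ hI.indep.subset_ground
  have hJf := M.set_finite _ hJ.indep.subset_ground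
  have hcl : M.E ⊆ M.closure (I ∪ J) := by
    rw [← hAB]
    exact union_subset (hI.subset_closure.trans (M.closure_subset_closure subset_union_left))
      (hJ.subset_closure.trans (M.closure_subset_closure subset_union_right))
  have hIJ : M.Indep (I ∪ J) := by
    rw [Matroid.indep_iff_eRk_eq_encard, ← M.eRk_closure_eq, Matroid.eRk_eq_eRank hcl,
      Matroid.eRank_def, ← natRk_cast, ← (hIf.union hJf).cast_ncard_eq,
      ncard_union_eq (hd.mono hI.subset hJ.subset) hIf hJf, ncard_eq_natRk hI, ncard_eq_natRk hJ]
    refine congrArg _ (hle.antisymm' ?_)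
    rw [← ncard_eq_natRk hI, ← ncard_eq_natRk hJ,
      ← ncard_union_eq (hd.mono hI.subset hJ.subset) hIf hJf]
    have h1 := M.eRk_le_encard (I ∪ J)
    rw [← M.eRk_closure_eq, Matroid.eRk_eq_eRank hcl, Matroid.eRank_def, ← natRk_cast,
      ← (hIf.union hJf).cast_ncard_eq] at h1
    exact_mod_cast h1
  refine hC.not_indep (hIJ.subset fun x hx => ?_)
  have : x ∈ A ∪ B := hAB ▸ hC.subset_ground hx
  exact this.elim (fun h => Or.inl (hCI ⟨hx, h⟩)) (fun h => Or.inr (hCJ ⟨hx, h⟩))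

end

section

variable {α : Type*}

theorem sum_ncard_inter {X : Set α} (hX : X.Finite) (P : Finset (Set α))
    (hP : (P : Set (Set α)).PairwiseDisjoint id) :
    ∑ F ∈ P, (X ∩ F).ncard = (X ∩ ⋃ F ∈ P, F).ncard := by
  classical
  induction P using Finset.induction_on with
  | empty => simp
  | insert A P hA ih =>
    rw [Finset.coe_insert] at hP
    rw [Finset.sum_insert hA, ih (hP.subset (subset_insert _ _)), Finset.set_biUnion_insert,
      inter_union_distrib_left, ncard_union_eq _ (hX.inter_of_left _) (hX.inter_of_left _)]
    refine Disjoint.mono inter_subset_right inter_subset_right ?_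
    rw [disjoint_iUnion₂_right]
    exact fun B hB => hP (mem_insert _ _) (mem_insert_of_mem _ hB) (fun h => hA (h ▸ hB))

/-- An intersecting family `L` with an intersecting submodular function `ρ` that takes
the value `1` on singletons. -/
structure IsSubmodularSystem (E : Set α) (L : Set (Set α)) (ρ : Set α → ℕ) : Prop where
  finite_ground : E.Finite
  subset_ground : ∀ F ∈ L, F ⊆ E
  inter_mem : ∀ F ∈ L, ∀ H ∈ L, (F ∩ H).Nonempty → F ∩ H ∈ L
  union_mem : ∀ F ∈ L, ∀ H ∈ L, (F ∩ H).Nonempty → F ∪ H ∈ L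
  submodular : ∀ F ∈ L, ∀ H ∈ L, (F ∩ H).Nonempty → ρ (F ∩ H) + ρ (F ∪ H) ≤ ρ F + ρ H
  singleton_mem : ∀ e ∈ E, {e} ∈ L
  apply_singleton : ∀ e ∈ E, ρ {e} = 1

/-- Independence in the matroid of a submodular system. -/
def IsIndep (E : Set α) (L : Set (Set α)) (ρ : Set α → ℕ) (I : Set α) : Prop :=
  I ⊆ E ∧ ∀ F ∈ L, (I ∩ F).ncard ≤ ρ F

variable {E : Set α} {L : Set (Set α)} {ρ : Set α → ℕ}

theorem IsIndep.subset {I J : Set α} (hE : E.Finite) (hJ : IsIndep E L ρ J) (h : I ⊆ J) :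
    IsIndep E L ρ I :=
  ⟨h.trans hJ.1, fun F hF => (ncard_le_ncard (inter_subset_inter_left F h)
    ((hE.subset hJ.1).inter_of_left F)).trans (hJ.2 F hF)⟩

namespace IsSubmodularSystem

variable (hS : IsSubmodularSystem E L ρ)
include hS

theorem exists_tight_mem {I : Set α} (hI : IsIndep E L ρ I) {e : α} (heE : e ∈ E)
    (he : e ∈ I ∨ ¬ IsIndep E L ρ (insert e I)) : ∃ F ∈ L, e ∈ F ∧ (I ∩ F).ncard = ρ F := by
  rcases he with he | he
  · refine ⟨{e}, hS.singleton_mem e heE, rfl, ?_⟩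
    rw [hS.apply_singleton e heE, inter_eq_self_of_subset_right (singleton_subset_iff.2 he),
      ncard_singleton]
  · by_contra! hno
    refine he ⟨insert_subset heE hI.1, fun F hF => ?_⟩
    by_cases heF : e ∈ F
    · rw [insert_inter_of_mem heF]
      exact (ncard_insert_le _ _).trans ((hI.2 F hF).lt_of_ne (hno F hF heF))
    · rw [insert_inter_of_notMem heF]
      exact hI.2 F hF

theorem tight_union {I F H : Set α} (hI : IsIndep E L ρ I) (hF : F ∈ L) (hH : H ∈ L)
    (hFH : (F ∩ H).Nonempty) (hFt : (I ∩ F).ncard = ρ F) (hHt : (I ∩ H).ncard = ρ H) :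
    (I ∩ (F ∪ H)).ncard = ρ (F ∪ H) := by
  have h1 := hS.submodular F hF H hH hFH
  have h2 := hI.2 _ (hS.inter_mem F hF H hH hFH)
  have h3 := hI.2 _ (hS.union_mem F hF H hH hFH)
  have hIf := hS.finite_ground.subset hI.1
  have h4 := ncard_inter_add_ncard_union (I ∩ F) (I ∩ H) (hIf.inter_of_left _)
    (hIf.inter_of_left _)
  rw [← inter_inter_distrib_left, ← inter_union_distrib_left] at h4
  omega

theorem exists_tight_cover {I S : Set α} (hI : IsIndep E L ρ I) (hSE : S ⊆ E)
    (he : ∀ e ∈ S, e ∈ I ∨ ¬ IsIndep E L ρ (insert e I)) :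
    ∃ P : Finset (Set α), (∀ F ∈ P, F ∈ L) ∧ (P : Set (Set α)).PairwiseDisjoint id ∧
      (∀ F ∈ P, (I ∩ F).ncard = ρ F) ∧ S ⊆ ⋃ F ∈ P, F := by
  let T : Set (Set α) := {F | F ∈ L ∧ (I ∩ F).ncard = ρ F}
  have hT : T.Finite := hS.finite_ground.finite_subsets.subset fun F hF =>
    hS.subset_ground F hF.1
  have hmax : {F | Maximal (· ∈ T) F}.Finite := hT.subset fun F hF => hF.prop
  refine ⟨hmax.toFinset, ?_, ?_, ?_, ?_⟩
  · exact fun F hF => ((hmax.mem_toFinset).1 hF).prop.1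
  · rw [hmax.coe_toFinset]
    intro F hF H hH hne
    rw [Function.onFun, id, id]
    by_contra hd
    rw [not_disjoint_iff_nonempty_inter] at hd
    have hU : F ∪ H ∈ T := ⟨hS.union_mem F hF.prop.1 H hH.prop.1 hd,
      hS.tight_union hI hF.prop.1 hH.prop.1 hd hF.prop.2 hH.prop.2⟩
    exact hne ((hF.eq_of_le hU subset_union_left).trans
      (hH.eq_of_le hU subset_union_right).symm)
  · exact fun F hF => ((hmax.mem_toFinset).1 hF).prop.2
  · intro e heS
    obtain ⟨F, hF, heF, hFt⟩ := hS.exists_tight_mem hI (hSE heS) (he e heS)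
    obtain ⟨H, hFH, hH⟩ := hT.exists_le_maximal (show F ∈ T from ⟨hF, hFt⟩)
    exact mem_iUnion₂.2 ⟨H, hmax.mem_toFinset.2 hH, hFH heF⟩

theorem augment {I J : Set α} (hI : IsIndep E L ρ I) (hJ : IsIndep E L ρ J)
    (hIJ : I.ncard < J.ncard) : ∃ e ∈ J, e ∉ I ∧ IsIndep E L ρ (insert e I) := by
  by_contra! hno
  obtain ⟨P, hPL, hPd, hPt, hJP⟩ := hS.exists_tight_cover hI hJ.1
    (fun e he => or_iff_not_imp_left.2 (hno e he))
  have hIf := hS.finite_ground.subset hI.1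
  have hJf := hS.finite_ground.subset hJ.1
  have h1 := sum_ncard_inter hIf P hPd
  have h2 := sum_ncard_inter hJf P hPd
  rw [inter_eq_self_of_subset_left hJP] at h2
  have h3 : ∑ F ∈ P, (J ∩ F).ncard ≤ ∑ F ∈ P, (I ∩ F).ncard :=
    Finset.sum_le_sum fun F hF => (hJ.2 F (hPL F hF)).trans (hPt F hF).ge
  have h4 : (I ∩ ⋃ F ∈ P, F).ncard ≤ I.ncard := ncard_le_ncard inter_subset_left hIf
  omega

/-- The matroid of a submodular system. -/
theorem exists_matroid : ∃ M : Matroid α, M.E = E ∧ ∀ I, M.Indep I ↔ IsIndep E L ρ I :=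
  ⟨(IndepMatroid.ofFinite hS.finite_ground (IsIndep E L ρ)
    ⟨empty_subset E, fun F _ => by simp⟩
    (fun _ _ hJ h => hJ.subset hS.finite_ground h)
    (fun _ _ hI hJ h => hS.augment hI hJ h) (fun _ hI => hI.1)).matroid, rfl, fun _ => Iff.rfl⟩

variable {M : Matroid α} (hME : M.E = E) (hM : ∀ I, M.Indep I ↔ IsIndep E L ρ I)
include hME

theorem finite_matroid : M.Finite := ⟨hME ▸ hS.finite_ground⟩

include hM

theorem natRk_le {F : Set α} (hF : F ∈ L) : natRk M F ≤ ρ F := by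
  obtain ⟨I, hI⟩ := M.exists_isBasis F (hME ▸ hS.subset_ground F hF)
  rw [← ncard_eq_natRk hI, ← inter_eq_self_of_subset_left hI.subset]
  exact ((hM I).1 hI.indep).2 F hF

theorem subset_closure_of_tight {I F : Set α} (hI : M.Indep I) (hF : F ∈ L)
    (ht : (I ∩ F).ncard = ρ F) : F ⊆ M.closure (I ∩ F) := by
  have hFE : F ⊆ M.E := hME ▸ hS.subset_ground F hF
  obtain ⟨J, hJ, hIJ⟩ := (hI.subset (inter_subset_left (t := F))).subset_isBasis_of_subset
    inter_subset_right hFE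
  have hJf : J.Finite := hS.finite_ground.subset (hME ▸ hJ.indep.subset_ground)
  have := eq_of_subset_of_ncard_le hIJ (by
    rw [ht, ncard_eq_natRk hJ]; exact hS.natRk_le hME hM hF) hJf
  rw [this]
  exact hJ.subset_closure

theorem exists_isBasis_tight_cover {S : Set α} (hSE : S ⊆ E) :
    ∃ I, M.IsBasis I S ∧ ∃ P : Finset (Set α), (∀ F ∈ P, F ∈ L) ∧
      (P : Set (Set α)).PairwiseDisjoint id ∧
      (∀ F ∈ P, (I ∩ F).ncard = ρ F) ∧ S ⊆ ⋃ F ∈ P, F := by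
  obtain ⟨I, hI⟩ := M.exists_isBasis S (hME ▸ hSE)
  refine ⟨I, hI, hS.exists_tight_cover ((hM I).1 hI.indep) hSE fun e he => ?_⟩
  rw [← hM]
  exact or_iff_not_imp_left.2 fun heI => (hI.insert_dep ⟨he, heI⟩).not_indep

theorem exists_cover_sum_le_natRk {S : Set α} (hSE : S ⊆ E) :
    ∃ P : Finset (Set α), (∀ F ∈ P, F ∈ L) ∧ (P : Set (Set α)).PairwiseDisjoint id ∧
      S ⊆ (⋃ F ∈ P, F) ∧ ∑ F ∈ P, ρ F ≤ natRk M S := by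
  obtain ⟨I, hI, P, hPL, hPd, hPt, hSP⟩ := hS.exists_isBasis_tight_cover hME hM hSE
  refine ⟨P, hPL, hPd, hSP, ?_⟩
  have hIf : I.Finite := hS.finite_ground.subset (hI.subset.trans hSE)
  rw [← Finset.sum_congr rfl hPt, sum_ncard_inter hIf P hPd, ← ncard_eq_natRk hI]
  exact ncard_le_ncard inter_subset_left hIf

/-- A nonempty flat with connected restriction belongs to the family. -/
theorem mem_of_isFlat_of_isConnected {S : Set α} (hSf : M.IsFlat S) (hne : S.Nonempty)
    (hc : IsConnected (M.restrict S)) : S ∈ L ∧ natRk M S = ρ S := by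
  have hfin := hS.finite_matroid hME
  have hSE : S ⊆ E := hME ▸ hSf.subset_ground
  obtain ⟨I, hI, P, hPL, hPd, hPt, hSP⟩ := hS.exists_isBasis_tight_cover hME hM hSE
  have hIf : I.Finite := hS.finite_ground.subset (hI.subset.trans hSE)
  have hcl (F) (hF : F ∈ P) := hS.subset_closure_of_tight hME hM hI.indep (hPL F hF) (hPt F hF)
  have hsub : ∀ F ∈ P, F ⊆ S := fun F hF => (hcl F hF).trans <| by
    rw [← hSf.closure]
    exact M.closure_subset_closure (inter_subset_left.trans hI.subset)
  obtain ⟨e, he⟩ := hne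
  obtain ⟨F, hF, heF⟩ := mem_iUnion₂.1 (hSP he)
  suffices h : F = S by
    subst h
    refine ⟨hPL F hF, ?_⟩
    rw [← hPt F hF, inter_eq_self_of_subset_left hI.subset, ncard_eq_natRk hI]
  by_contra hFS
  have : (M.restrict S).Finite := ⟨hS.finite_ground.subset hSE⟩
  have hlt := hc.lt (A := F) (B := S \ F) ⟨e, heF⟩
    (nonempty_of_ssubset ((hsub F hF).ssubset_of_ne hFS)) disjoint_sdiff_right
    (union_sdiff_cancel (hsub F hF))
  rw [Matroid.restrict_ground_eq, natRk_restrict (hsub F hF), natRk_restrict sdiff_subset,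
    natRk_restrict subset_rfl, ← ncard_eq_natRk hI] at hlt
  have h1 : natRk M F ≤ (I ∩ F).ncard := (hPt F hF).symm ▸ hS.natRk_le hME hM (hPL F hF)
  have h2 : natRk M (S \ F) ≤ (I \ F).ncard := by
    have hIF : M.Indep (I \ F) := hI.indep.subset sdiff_subset
    have hss : S \ F ⊆ M.closure (I \ F) := by
      rintro x ⟨hxS, hxF⟩
      obtain ⟨H, hH, hxH⟩ := mem_iUnion₂.1 (hSP hxS)
      refine M.closure_subset_closure ?_ (hcl H hH hxH)
      rintro y ⟨hyI, hyH⟩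
      exact ⟨hyI, fun hyF => (hPd hH hF (fun h => hxF (h ▸ hxH))).ne_of_mem hyH hyF rfl⟩
    have hb : M.IsBasis (I \ F) (S \ F) :=
      hIF.isBasis_of_subset_of_subset_closure (sdiff_subset_sdiff_left hI.subset) hss
    rw [ncard_eq_natRk hb]
  have h3 := ncard_inter_add_ncard_sdiff_eq_ncard I F hIf
  omega

end IsSubmodularSystem

end

section

variable {α : Type*}

/-- `A` is the complement of a member of `𝒢`. -/
def IsCo (E : Set α) (𝒢 : Set (Set α)) (A : Set α) : Prop := A ⊆ E ∧ E \ A ∈ 𝒢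

/-- `X` is a union of at most `n` complements of members of `𝒢`. -/
def IsCoUnion (E : Set α) (𝒢 : Set (Set α)) (n : ℕ) (X : Set α) : Prop :=
  ∃ P : Finset (Set α), (∀ A ∈ P, IsCo E 𝒢 A) ∧ P.card ≤ n ∧ ⋃ A ∈ P, A = X

variable {E : Set α} {𝒢 : Set (Set α)} {δ : ℕ}

theorem IsCoUnion.union {m n : ℕ} {X Y : Set α} (hX : IsCoUnion E 𝒢 m X)
    (hY : IsCoUnion E 𝒢 n Y) : IsCoUnion E 𝒢 (m + n) (X ∪ Y) := by
  classical
  obtain ⟨P, hP, hPc, rfl⟩ := hX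
  obtain ⟨Q, hQ, hQc, rfl⟩ := hY
  refine ⟨P ∪ Q, fun A hA => (Finset.mem_union.1 hA).elim (hP A) (hQ A),
    (Finset.card_union_le _ _).trans (add_le_add hPc hQc), Finset.set_biUnion_union _ _ _⟩

theorem IsCoUnion.subset {n : ℕ} {X : Set α} (h : IsCoUnion E 𝒢 n X) : X ⊆ E := by
  obtain ⟨P, hP, -, rfl⟩ := h
  exact iUnion₂_subset fun A hA => (hP A hA).1

theorem isCoUnion_of_isInterOf (hsub : ∀ G ∈ 𝒢, G ⊆ E) {k : ℕ} {F : Set α}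
    (h : IsInterOf E 𝒢 k F) : IsCoUnion E 𝒢 k (E \ F) := by
  classical
  obtain ⟨G, hG, rfl⟩ := h
  refine ⟨Finset.univ.image fun i => E \ G i, ?_, ?_, ?_⟩
  · intro A hA
    obtain ⟨i, -, rfl⟩ := Finset.mem_image.1 hA
    exact ⟨sdiff_subset, by rw [sdiff_sdiff_cancel_left (hsub _ (hG i))]; exact hG i⟩
  · exact Finset.card_image_le.trans (by simp)
  · ext x
    simp

theorem isInterOf_of_finset {P : Finset (Set α)} (hP : ∀ A ∈ P, IsCo E 𝒢 A) :
    IsInterOf E 𝒢 P.card (E \ ⋃ A ∈ P, A) := by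
  refine ⟨fun i => E \ (P.equivFin.symm i : Set α), fun i => (hP _ (Subtype.prop _)).2, ?_⟩
  ext x
  simp only [mem_sdiff, mem_iUnion, not_exists, mem_inter_iff, mem_iInter]
  refine and_congr_right fun hx => ⟨fun h i => ⟨hx, h _ (Subtype.prop _)⟩, fun h A hA => ?_⟩
  have := (h (P.equivFin ⟨A, hA⟩)).2
  rwa [Equiv.symm_apply_apply] at this

theorem IsInterOf.subset {k : ℕ} {F : Set α} (h : IsInterOf E 𝒢 k F) : F ⊆ E := by
  obtain ⟨G, -, rfl⟩ := h
  exact inter_subset_left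

theorem subset_of_mem_interClosure {F : Set α} (h : F ∈ interClosure E 𝒢) : F ⊆ E := by
  obtain ⟨-, k, hk⟩ := h
  exact hk.subset

theorem mem_interClosure_of_isCoUnion {n : ℕ} {F : Set α} (hF : F ⊆ E) (hne : F.Nonempty)
    (h : IsCoUnion E 𝒢 n (E \ F)) : F ∈ interClosure E 𝒢 := by
  obtain ⟨P, hP, -, hPU⟩ := h
  refine ⟨hne, P.card, ?_⟩
  have := isInterOf_of_finset hP
  rwa [hPU, sdiff_sdiff_cancel_left hF] at this

theorem interCount_le {n : ℕ} {F : Set α} (hF : F ⊆ E)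
    (h : IsCoUnion E 𝒢 n (E \ F)) : interCount E 𝒢 F ≤ n := by
  obtain ⟨P, hP, hc, hPU⟩ := h
  have := isInterOf_of_finset hP
  rw [hPU, sdiff_sdiff_cancel_left hF] at this
  exact (Nat.sInf_le this).trans hc

theorem isCoUnion_interCount (hsub : ∀ G ∈ 𝒢, G ⊆ E) {F : Set α} (hF : F ∈ interClosure E 𝒢) :
    IsCoUnion E 𝒢 (interCount E 𝒢 F) (E \ F) :=
  isCoUnion_of_isInterOf hsub (Nat.sInf_mem hF.2)

theorem sdiff_ne_of_mem_interClosure {F : Set α} (hF : F ∈ interClosure E 𝒢) : E \ F ≠ E := by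
  obtain ⟨x, hx⟩ := hF.1
  exact fun h => (h.symm ▸ subset_of_mem_interClosure hF hx : x ∈ E \ F).2 hx

namespace IsGFamily

variable (h𝒢 : IsGFamily δ E 𝒢)
include h𝒢

theorem co_union {A B : Set α} (hA : IsCo E 𝒢 A) (hB : IsCo E 𝒢 B) (hAB : (A ∩ B).Nonempty)
    (hne : A ∪ B ≠ E) : IsCo E 𝒢 (A ∪ B) ∧ IsCo E 𝒢 (A ∩ B) := by
  have h1 : ((E \ A) ∩ (E \ B)).Nonempty := by
    rw [sdiff_inter_sdiff]
    exact nonempty_of_ssubset ((union_subset hA.1 hB.1).ssubset_of_ne hne)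
  have h2 : (E \ A) ∪ (E \ B) ≠ E := by
    rw [← sdiff_inter]
    obtain ⟨x, hx⟩ := hAB
    exact fun h => (h.symm ▸ hA.1 hx.1 : x ∈ E \ (A ∩ B)).2 hx
  refine ⟨⟨union_subset hA.1 hB.1, ?_⟩, inter_subset_left.trans hA.1, ?_⟩
  · rw [← sdiff_inter_sdiff]
    exact h𝒢.inter_mem _ hA.2 _ hB.2 h1 h2
  · rw [sdiff_inter]
    exact h𝒢.union_mem _ hA.2 _ hB.2 h1 h2

theorem co_biUnion {A : Set α} (hA : IsCo E 𝒢 A) (D : Finset (Set α))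
    (hD : ∀ B ∈ D, IsCo E 𝒢 B ∧ (B ∩ A).Nonempty) (hne : (⋃ B ∈ D, B) ∪ A ≠ E) :
    IsCo E 𝒢 ((⋃ B ∈ D, B) ∪ A) := by
  classical
  induction D using Finset.induction_on with
  | empty => simpa using hA
  | insert B D hB ih =>
    rw [Finset.set_biUnion_insert, union_assoc] at hne ⊢
    have hBD := hD B (Finset.mem_insert_self _ _)
    have hsub : (⋃ C ∈ D, C) ∪ A ⊆ E :=
      union_subset (iUnion₂_subset fun C hC => (hD C (Finset.mem_insert_of_mem hC)).1.1) hA.1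
    refine (h𝒢.co_union hBD.1 (ih (fun C hC => hD C (Finset.mem_insert_of_mem hC)) ?_)
      (hBD.2.mono (inter_subset_inter_right _ subset_union_right)) hne).1
    exact fun h => hne (by rw [h, union_eq_right]; exact hBD.1.1)

theorem coUnion_modular_step {n : ℕ} {X A : Set α} (hX : IsCoUnion E 𝒢 n X) (hA : IsCo E 𝒢 A)
    (hne : X ∪ A ≠ E) :
    ∃ p q, IsCoUnion E 𝒢 p (X ∪ A) ∧ IsCoUnion E 𝒢 q (X ∩ A) ∧ p + q ≤ n + 1 := by
  classical
  have hXE := hX.subset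
  obtain ⟨P, hP, hc, rfl⟩ := hX
  let D := P.filter fun B => (B ∩ A).Nonempty
  have hDP : ∀ B ∈ D, B ∈ P := fun B hB => (Finset.mem_filter.1 hB).1
  have hDA : ∀ B ∈ D, IsCo E 𝒢 B ∧ (B ∩ A).Nonempty := fun B hB =>
    ⟨hP B (hDP B hB), (Finset.mem_filter.1 hB).2⟩
  have hne' {Y : Set α} (hY : Y ⊆ (⋃ B ∈ P, B) ∪ A) : Y ≠ E := fun h =>
    hne ((union_subset hXE hA.1).antisymm (h ▸ hY))
  have hDs : (⋃ B ∈ D, B) ⊆ ⋃ B ∈ P, B := iUnion₂_subset fun B hB =>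
    subset_biUnion_of_mem (u := fun B : Set α => B) (hDP B hB)
  refine ⟨(P \ D).card + 1, D.card, ⟨insert ((⋃ B ∈ D, B) ∪ A) (P \ D), ?_,
    Finset.card_insert_le _ _, ?_⟩, ⟨D.image (· ∩ A), ?_, Finset.card_image_le, ?_⟩, ?_⟩
  · intro B hB
    rcases Finset.mem_insert.1 hB with rfl | hB
    · exact h𝒢.co_biUnion hA D hDA (hne' (union_subset_union_left _ hDs))
    · exact hP B (Finset.mem_sdiff.1 hB).1
  · have hu : D ∪ P \ D = P := Finset.union_sdiff_of_subset hDP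
    rw [Finset.set_biUnion_insert, union_right_comm, ← Finset.set_biUnion_union, hu]
  · intro B hB
    obtain ⟨C, hC, rfl⟩ := Finset.mem_image.1 hB
    exact (h𝒢.co_union (hDA C hC).1 hA (hDA C hC).2 (hne' (union_subset_union_left _
      (subset_biUnion_of_mem (u := fun B : Set α => B) (hDP C hC))))).2
  · ext x
    simp only [Finset.mem_image, iUnion_exists, biUnion_and', iUnion_iUnion_eq_right, mem_iUnion,
      mem_inter_iff, exists_prop, D, Finset.mem_filter]
    constructor
    · rintro ⟨B, ⟨hB, -⟩, hx, hxA⟩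
      exact ⟨⟨B, hB, hx⟩, hxA⟩
    · rintro ⟨⟨B, hB, hx⟩, hxA⟩
      exact ⟨B, ⟨hB, x, hx, hxA⟩, hx, hxA⟩
  · have := Finset.card_sdiff_add_card_eq_card (s := D) (t := P) hDP
    omega

theorem coUnion_modular {n : ℕ} {X : Set α} (hX : IsCoUnion E 𝒢 n X) (Q : Finset (Set α))
    (hQ : ∀ A ∈ Q, IsCo E 𝒢 A) (hd : (Q : Set (Set α)).PairwiseDisjoint id)
    (hne : X ∪ ⋃ A ∈ Q, A ≠ E) :
    ∃ p q, IsCoUnion E 𝒢 p (X ∪ ⋃ A ∈ Q, A) ∧ IsCoUnion E 𝒢 q (X ∩ ⋃ A ∈ Q, A) ∧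
      p + q ≤ n + Q.card := by
  classical
  induction Q using Finset.induction_on with
  | empty => exact ⟨n, 0, by simpa using hX, ⟨∅, by simp⟩, by simp⟩
  | insert B Q hB ih =>
    rw [Finset.coe_insert] at hd
    have hBco := hQ B (Finset.mem_insert_self _ _)
    have hQco : ∀ A ∈ Q, IsCo E 𝒢 A := fun A hA => hQ A (Finset.mem_insert_of_mem hA)
    have hdj : (⋃ A ∈ Q, A) ∩ B = ∅ := by
      rw [← disjoint_iff_inter_eq_empty, disjoint_iUnion₂_left]
      exact fun A hA => hd (mem_insert_of_mem _ hA) (mem_insert _ _) fun h => hB (h ▸ hA)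
    rw [Finset.set_biUnion_insert, union_comm B, ← union_assoc] at hne ⊢
    have hXE := hX.subset
    obtain ⟨p, q, hp, hq, hpq⟩ := ih hQco (hd.subset (subset_insert _ _))
      (fun h => hne (by rw [h, union_eq_left]; exact hBco.1))
    obtain ⟨p', q', hp', hq', hpq'⟩ := h𝒢.coUnion_modular_step hp hBco hne
    rw [union_inter_distrib_right, hdj, union_empty] at hq'
    refine ⟨p', q + q', hp', ?_, ?_⟩
    · rw [inter_union_distrib_left]
      exact hq.union hq'
    · rw [Finset.card_insert_of_notMem hB]
      omega

/-- A union of complements of members is a disjoint union of at most as many. -/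
theorem exists_disjoint_coUnion {n : ℕ} {X : Set α} (hX : IsCoUnion E 𝒢 n X) (hne : X ≠ E) :
    ∃ P : Finset (Set α), (∀ A ∈ P, IsCo E 𝒢 A) ∧ P.card ≤ n ∧ ⋃ A ∈ P, A = X ∧
      (P : Set (Set α)).PairwiseDisjoint id := by
  classical
  have hXE := hX.subset
  induction n using Nat.strong_induction_on with
  | _ n ih =>
  obtain ⟨P, hP, hc, hPX⟩ := hX
  by_cases hd : (P : Set (Set α)).PairwiseDisjoint id
  · exact ⟨P, hP, hc, hPX, hd⟩
  · simp only [Set.PairwiseDisjoint, Set.Pairwise, not_forall] at hd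
    obtain ⟨A, hA, B, hB, hAB, hd⟩ := hd
    rw [Function.onFun, id, id, not_disjoint_iff_nonempty_inter] at hd
    have hA' : A ∈ P := hA
    have hB' : B ∈ P.erase A := Finset.mem_erase.2 ⟨hAB.symm, hB⟩
    have hins : insert A (insert B ((P.erase A).erase B)) = P := by
      rw [Finset.insert_erase hB', Finset.insert_erase hA']
    have hPX' : (A ∪ B) ∪ ⋃ C ∈ (P.erase A).erase B, C = X := by
      rw [← hPX]
      conv_rhs => rw [← hins]
      rw [Finset.set_biUnion_insert, Finset.set_biUnion_insert, union_assoc]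
    have hABX : A ∪ B ⊆ X := hPX' ▸ subset_union_left
    have hco := (h𝒢.co_union (hP A hA) (hP B hB) hd
      (fun h => hne (hXE.antisymm (h ▸ hABX)))).1
    have hc1 := Finset.card_erase_add_one hA'
    have hc2 := Finset.card_erase_add_one hB'
    have hcard := Finset.card_insert_le (A ∪ B) ((P.erase A).erase B)
    obtain ⟨Q, hQ, hQc, hQX, hQd⟩ := ih (n - 1) (by omega)
      ⟨insert (A ∪ B) ((P.erase A).erase B), fun C hC => (Finset.mem_insert.1 hC).elim
        (fun h => h ▸ hco)
        (fun h => hP C (Finset.mem_of_mem_erase (Finset.mem_of_mem_erase h))),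
        by omega, by rw [Finset.set_biUnion_insert, hPX']⟩
    exact ⟨Q, hQ, by omega, hQX, hQd⟩

theorem exists_disjoint_interCount {F : Set α} (hF : F ∈ interClosure E 𝒢) :
    ∃ P : Finset (Set α), (∀ A ∈ P, IsCo E 𝒢 A) ∧ P.card = interCount E 𝒢 F ∧
      ⋃ A ∈ P, A = E \ F ∧ (P : Set (Set α)).PairwiseDisjoint id := by
  obtain ⟨P, hP, hc, hPX, hd⟩ := h𝒢.exists_disjoint_coUnion
    (isCoUnion_interCount h𝒢.subset_ground hF) (sdiff_ne_of_mem_interClosure hF)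
  exact ⟨P, hP, hc.antisymm (interCount_le (subset_of_mem_interClosure hF)
    ⟨P, hP, le_rfl, hPX⟩), hPX, hd⟩

theorem interClosure_submodular {F H : Set α} (hF : F ∈ interClosure E 𝒢)
    (hH : H ∈ interClosure E 𝒢) (hne : (F ∩ H).Nonempty) :
    F ∩ H ∈ interClosure E 𝒢 ∧ F ∪ H ∈ interClosure E 𝒢 ∧
      interCount E 𝒢 (F ∩ H) + interCount E 𝒢 (F ∪ H) ≤
        interCount E 𝒢 F + interCount E 𝒢 H := by
  obtain ⟨Q, hQ, hQc, hQH, hQd⟩ := h𝒢.exists_disjoint_interCount hH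
  have hFE := subset_of_mem_interClosure hF
  have hHE := subset_of_mem_interClosure hH
  have hneE : (E \ F) ∪ (E \ H) ≠ E := by
    rw [← sdiff_inter]
    obtain ⟨x, hx⟩ := hne
    exact fun h => (h.symm ▸ hFE hx.1 : x ∈ E \ (F ∩ H)).2 hx
  obtain ⟨p, q, hp, hq, hpq⟩ := h𝒢.coUnion_modular
    (isCoUnion_interCount h𝒢.subset_ground hF) Q hQ hQd (by rwa [hQH])
  rw [hQH, ← sdiff_inter] at hp
  rw [hQH, sdiff_inter_sdiff] at hq
  have hIE : F ∩ H ⊆ E := inter_subset_left.trans hFE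
  have hUE : F ∪ H ⊆ E := union_subset hFE hHE
  refine ⟨mem_interClosure_of_isCoUnion hIE hne hp, mem_interClosure_of_isCoUnion hUE
    (hne.mono (inter_subset_left.trans subset_union_left)) hq, ?_⟩
  have h1 := interCount_le hIE hp
  have h2 := interCount_le hUE hq
  omega

end IsGFamily

end

section

variable {α : Type*} {E : Set α} {𝒢 : Set (Set α)} {δ : ℕ}

/-- The weight `((δ - 1)|F| + c(F)) / δ`, rounded down to a natural number. -/
noncomputable def natWeight (δ : ℕ) (E : Set α) (𝒢 : Set (Set α)) (F : Set α) : ℕ :=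
  ((δ - 1) * F.ncard + interCount E 𝒢 F) / δ

theorem interCount_pos (hsub : ∀ G ∈ 𝒢, G ⊆ E) {F : Set α} (hF : F ∈ interClosure E 𝒢)
    (hne : F ≠ E) : 1 ≤ interCount E 𝒢 F := by
  by_contra h
  obtain ⟨P, -, hc, hP⟩ := isCoUnion_interCount hsub hF
  have hP0 : P = ∅ := Finset.card_eq_zero.1 (by omega)
  subst hP0
  exact hne ((subset_of_mem_interClosure hF).antisymm (sdiff_eq_empty.1 (by simpa using hP.symm)))

theorem ground_mem_interClosure (hE : E.Nonempty) : E ∈ interClosure E 𝒢 :=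
  ⟨hE, 0, Fin.elim0, fun i => i.elim0, by simp⟩

theorem interCount_ground : interCount E 𝒢 E = 0 :=
  Nat.le_zero.1 (Nat.sInf_le ⟨Fin.elim0, fun i => i.elim0, by simp⟩)

theorem IsCo.isCoUnion {A : Set α} (hA : IsCo E 𝒢 A) : IsCoUnion E 𝒢 1 A :=
  ⟨{A}, by simpa using hA, by simp, by simp⟩

theorem not_dvd_one (hδ : 2 < δ) : ¬ (δ : ℤ) ∣ 1 := fun h => by
  have := Int.le_of_dvd one_pos h
  omega

namespace IsGFamily

variable (h𝒢 : IsGFamily δ E 𝒢)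
include h𝒢

theorem dvd_ncard_ground : (δ : ℤ) ∣ E.ncard := by
  obtain ⟨g, -, hg⟩ := h𝒢.card_ground
  exact ⟨E.ncard - g, by linear_combination -hg⟩

theorem dvd_ncard_co {A : Set α} (hA : IsCo E 𝒢 A) : (δ : ℤ) ∣ (A.ncard + 1 : ℕ) := by
  obtain ⟨g, -, hg⟩ := h𝒢.card_mem _ hA.2
  obtain ⟨k, hk⟩ := h𝒢.dvd_ncard_ground
  have h := ncard_sdiff_add_ncard_of_subset hA.1 h𝒢.finite_ground
  have h' : ((E \ A).ncard : ℤ) + A.ncard = E.ncard := by exact_mod_cast h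
  refine ⟨k + g - (E \ A).ncard, ?_⟩
  push_cast
  linear_combination h' + hk + hg

theorem dvd_weight {F : Set α} (hF : F ∈ interClosure E 𝒢) :
    (δ : ℤ) ∣ (interCount E 𝒢 F : ℤ) - F.ncard := by
  obtain ⟨P, hP, hPc, hPF, hPd⟩ := h𝒢.exists_disjoint_interCount hF
  have h1 := sum_ncard_inter h𝒢.finite_ground P hPd
  rw [hPF, inter_eq_self_of_subset_right sdiff_subset,
    Finset.sum_congr rfl fun A hA => by rw [inter_eq_self_of_subset_right (hP A hA).1]] at h1
  have h2 := ncard_sdiff_add_ncard_of_subset (subset_of_mem_interClosure hF) h𝒢.finite_ground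
  have h3 : (δ : ℤ) ∣ ∑ A ∈ P, ((A.ncard + 1 : ℕ) : ℤ) :=
    Finset.dvd_sum fun A hA => h𝒢.dvd_ncard_co (hP A hA)
  rw [← Nat.cast_sum, Finset.sum_add_distrib, h1, Finset.sum_const, smul_eq_mul, mul_one,
    hPc] at h3
  have h4 := dvd_sub h3 h𝒢.dvd_ncard_ground
  rw [← h2] at h4
  push_cast at h4
  rwa [add_sub_add_left_eq_sub] at h4

variable (hδ : 2 < δ)
include hδ

theorem mul_natWeight {F : Set α} (hF : F ∈ interClosure E 𝒢) :
    δ * natWeight δ E 𝒢 F + F.ncard = δ * F.ncard + interCount E 𝒢 F := by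
  obtain ⟨k, hk⟩ := h𝒢.dvd_weight hF
  obtain ⟨d, rfl⟩ : ∃ d, δ = d + 1 := ⟨δ - 1, by omega⟩
  have hdvd : (d + 1) ∣ d * F.ncard + interCount E 𝒢 F := by
    zify
    refine ⟨F.ncard + k, ?_⟩
    push_cast at hk ⊢
    linear_combination hk
  rw [natWeight, Nat.add_sub_cancel, Nat.mul_div_cancel' hdvd]
  ring

theorem weight_eq_natWeight {F : Set α} (hF : F ∈ interClosure E 𝒢) :
    weight δ E 𝒢 F = natWeight δ E 𝒢 F := by
  have h : (δ : ℚ) * natWeight δ E 𝒢 F + F.ncard = δ * F.ncard + interCount E 𝒢 F := by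
    exact_mod_cast h𝒢.mul_natWeight hδ hF
  have hδ0 : (δ : ℚ) ≠ 0 := by positivity
  rw [weight, div_eq_iff hδ0]
  linear_combination -h

theorem nonempty_of_mem {G : Set α} (hG : G ∈ 𝒢) : G.Nonempty := by
  by_contra hne
  rw [not_nonempty_iff_eq_empty] at hne
  obtain ⟨g, -, hg⟩ := h𝒢.card_mem G hG
  rw [hne, ncard_empty] at hg
  exact not_dvd_one hδ ⟨g, by push_cast at hg; linear_combination hg⟩

theorem ne_ground_of_mem {G : Set α} (hG : G ∈ 𝒢) : G ≠ E := by
  rintro rfl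
  obtain ⟨g, -, hg⟩ := h𝒢.card_mem G hG
  obtain ⟨g₀, -, hg₀⟩ := h𝒢.card_ground
  exact not_dvd_one hδ ⟨g - g₀, by linear_combination hg - hg₀⟩

theorem co_nonempty {A : Set α} (hA : IsCo E 𝒢 A) : A.Nonempty := by
  by_contra hne
  rw [not_nonempty_iff_eq_empty] at hne
  exact h𝒢.ne_ground_of_mem hδ hA.2 (by rw [hne, sdiff_empty])

theorem mem_interClosure {G : Set α} (hG : G ∈ 𝒢) : G ∈ interClosure E 𝒢 :=
  ⟨h𝒢.nonempty_of_mem hδ hG, 1, fun _ => G, fun _ => hG, by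
    rw [iInter_const, inter_eq_self_of_subset_right (h𝒢.subset_ground G hG)]⟩

theorem interCount_of_mem {G : Set α} (hG : G ∈ 𝒢) : interCount E 𝒢 G = 1 := by
  refine le_antisymm (Nat.sInf_le ⟨fun _ => G, fun _ => hG, ?_⟩) (interCount_pos
    h𝒢.subset_ground (h𝒢.mem_interClosure hδ hG) (h𝒢.ne_ground_of_mem hδ hG))
  rw [iInter_const, inter_eq_self_of_subset_right (h𝒢.subset_ground G hG)]

theorem mul_natWeight_of_mem {G : Set α} (hG : G ∈ 𝒢) :
    δ * natWeight δ E 𝒢 G + G.ncard = δ * G.ncard + 1 := by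
  rw [h𝒢.mul_natWeight hδ (h𝒢.mem_interClosure hδ hG), h𝒢.interCount_of_mem hδ hG]

theorem mul_natWeight_ground (hE : E.Nonempty) :
    δ * natWeight δ E 𝒢 E + E.ncard = δ * E.ncard := by
  rw [h𝒢.mul_natWeight hδ (ground_mem_interClosure hE), interCount_ground, add_zero]

theorem isSubmodularSystem :
    IsSubmodularSystem E (interClosure E 𝒢) (natWeight δ E 𝒢) where
  finite_ground := h𝒢.finite_ground
  subset_ground _ hF := subset_of_mem_interClosure hF
  inter_mem _ hF _ hH hne := (h𝒢.interClosure_submodular hF hH hne).1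
  union_mem _ hF _ hH hne := (h𝒢.interClosure_submodular hF hH hne).2.1
  submodular F hF H hH hne := by
    obtain ⟨hI, hU, hc⟩ := h𝒢.interClosure_submodular hF hH hne
    have h1 := h𝒢.mul_natWeight hδ hF
    have h2 := h𝒢.mul_natWeight hδ hH
    have h3 := h𝒢.mul_natWeight hδ hI
    have h4 := h𝒢.mul_natWeight hδ hU
    have h5 := ncard_inter_add_ncard_union F H
      (h𝒢.finite_ground.subset (subset_of_mem_interClosure hF))
      (h𝒢.finite_ground.subset (subset_of_mem_interClosure hH))
    have h6 := congrArg (δ * ·) h5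
    simp only [mul_add] at h6
    refine Nat.le_of_mul_le_mul_left (c := δ) ?_ (by omega)
    rw [mul_add, mul_add]
    omega
  singleton_mem e he := h𝒢.mem_interClosure hδ (h𝒢.singleton_mem e he)
  apply_singleton e he := by
    have := h𝒢.mul_natWeight_of_mem hδ (h𝒢.singleton_mem e he)
    rw [ncard_singleton] at this
    exact Nat.eq_of_mul_eq_mul_left (show 0 < δ by omega) (by omega)

theorem isPreCircuit_iff {C : Set α} : IsPreCircuit δ E 𝒢 C ↔
    ∃ F ∈ interClosure E 𝒢, C ⊆ F ∧ C.ncard = natWeight δ E 𝒢 F + 1 := by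
  refine exists_congr fun F => and_congr_right fun hF => and_congr_right fun _ => ?_
  rw [h𝒢.weight_eq_natWeight hδ hF]
  norm_cast

theorem not_isIndep_iff {X : Set α} (hX : X ⊆ E) :
    ¬ IsIndep E (interClosure E 𝒢) (natWeight δ E 𝒢) X ↔ ∃ C ⊆ X, IsPreCircuit δ E 𝒢 C := by
  simp only [h𝒢.isPreCircuit_iff hδ, IsIndep, hX, true_and, not_forall, not_le]
  constructor
  · rintro ⟨F, hF, hlt⟩
    obtain ⟨C, hC, hcard⟩ := exists_subset_card_eq (Nat.succ_le_of_lt hlt)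
    exact ⟨C, hC.trans inter_subset_left, F, hF, hC.trans inter_subset_right, hcard⟩
  · rintro ⟨C, hCX, F, hF, hCF, hcard⟩
    refine ⟨F, hF, ?_⟩
    have := ncard_le_ncard (subset_inter hCX hCF) ((h𝒢.finite_ground.subset hX).inter_of_left F)
    omega

theorem isCircuit_iff_of_indep_iff {M : Matroid α} (hME : M.E = E)
    (hM : ∀ I, M.Indep I ↔ IsIndep E (interClosure E 𝒢) (natWeight δ E 𝒢) I) (C : Set α) :
    M.IsCircuit C ↔ Minimal (IsPreCircuit δ E 𝒢) C := by
  have hdep (X : Set α) : M.Dep X ↔ X ⊆ E ∧ ∃ C ⊆ X, IsPreCircuit δ E 𝒢 C := by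
    rw [Matroid.Dep, hM, hME, and_comm]
    exact and_congr_right fun hX => h𝒢.not_isIndep_iff hδ hX
  have hpre {X : Set α} (hX : IsPreCircuit δ E 𝒢 X) : M.Dep X := by
    refine (hdep X).2 ⟨?_, X, subset_rfl, hX⟩
    obtain ⟨F, hF, hXF, -⟩ := hX
    exact hXF.trans (subset_of_mem_interClosure hF)
  rw [Matroid.isCircuit_def]
  constructor
  · intro h
    obtain ⟨D, hDC, hD⟩ := ((hdep C).1 h.prop).2
    have := h.eq_of_le (hpre hD) hDC
    subst this
    exact ⟨hD, fun X hX hXC => h.le_of_le (hpre hX) hXC⟩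
  · intro h
    refine ⟨hpre h.prop, fun X hX hXC => ?_⟩
    obtain ⟨D, hDX, hD⟩ := ((hdep X).1 hX).2
    exact (h.le_of_le hD (hDX.trans hXC)).trans hDX

theorem exists_isGMatroid : ∃ M : Matroid α, IsGMatroid δ E 𝒢 M ∧
    ∀ I, M.Indep I ↔ IsIndep E (interClosure E 𝒢) (natWeight δ E 𝒢) I := by
  obtain ⟨M, hME, hM⟩ := (h𝒢.isSubmodularSystem hδ).exists_matroid
  exact ⟨M, ⟨hME, Set.ext fun C => h𝒢.isCircuit_iff_of_indep_iff hδ hME hM C⟩, hM⟩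

omit h𝒢 hδ in
theorem isGMatroid_unique {M N : Matroid α} (hM : IsGMatroid δ E 𝒢 M)
    (hN : IsGMatroid δ E 𝒢 N) : M = N :=
  Matroid.ext_isCircuit (hM.1.trans hN.1.symm) fun C _ => by
    have := hM.2.trans hN.2.symm
    exact Set.ext_iff.1 this C

end IsGFamily

/-- The matroid given by the weights on the intersection closure. -/
def IsWeightMatroid (δ : ℕ) (E : Set α) (𝒢 : Set (Set α)) (M : Matroid α) : Prop :=
  M.E = E ∧ ∀ I, M.Indep I ↔ IsIndep E (interClosure E 𝒢) (natWeight δ E 𝒢) I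

namespace IsGFamily

variable (h𝒢 : IsGFamily δ E 𝒢) (hδ : 2 < δ) {M : Matroid α} (hM : IsWeightMatroid δ E 𝒢 M)
include h𝒢 hδ hM

theorem natRk_le_natWeight {F : Set α} (hF : F ∈ interClosure E 𝒢) :
    natRk M F ≤ natWeight δ E 𝒢 F :=
  (h𝒢.isSubmodularSystem hδ).natRk_le hM.1 hM.2 hF

theorem natRk_lower_bound_or {S : Set α} (hSE : S ⊆ E) (hne : S.Nonempty) :
    δ * S.ncard + 1 ≤ δ * natRk M S + S.ncard ∨ natWeight δ E 𝒢 E ≤ natRk M S := by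
  obtain ⟨P, hPL, hPd, hSP, hle⟩ :=
    (h𝒢.isSubmodularSystem hδ).exists_cover_sum_le_natRk hM.1 hM.2 hSE
  by_cases hEP : E ∈ P
  · exact Or.inr ((Finset.single_le_sum (f := natWeight δ E 𝒢) (fun _ _ => Nat.zero_le _)
      hEP).trans hle)
  left
  have hPE : ∀ F ∈ P, F ⊆ E := fun F hF => subset_of_mem_interClosure (hPL F hF)
  have h1 := sum_ncard_inter h𝒢.finite_ground P hPd
  rw [Finset.sum_congr rfl fun A hA => by rw [inter_eq_self_of_subset_right (hPE A hA)]] at h1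
  have h2 : S.ncard ≤ ∑ F ∈ P, F.ncard := by
    rw [h1]
    exact ncard_le_ncard (subset_inter hSE hSP) (h𝒢.finite_ground.inter_of_left _)
  have h3 : 1 ≤ P.card := by
    obtain ⟨x, hx⟩ := hne
    obtain ⟨F, hF, -⟩ := mem_iUnion₂.1 (hSP hx)
    exact Finset.card_pos.2 ⟨F, hF⟩
  have h4 : ∑ F ∈ P, (δ * F.ncard + 1) ≤ ∑ F ∈ P, (δ * natWeight δ E 𝒢 F + F.ncard) :=
    Finset.sum_le_sum fun F hF => by
      rw [h𝒢.mul_natWeight hδ (hPL F hF)]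
      have := interCount_pos h𝒢.subset_ground (hPL F hF) (fun h => hEP (h ▸ hF))
      omega
  simp only [Finset.sum_add_distrib, ← Finset.mul_sum, Finset.sum_const, smul_eq_mul,
    mul_one] at h4
  have h5 := Nat.mul_le_mul_left δ hle
  obtain ⟨t, ht⟩ := Nat.exists_eq_add_of_le h2
  rw [ht] at h4
  have h6 : t ≤ δ * t := Nat.le_mul_of_pos_left t (by omega)
  rw [mul_add] at h4
  omega

theorem natRk_ground (hE : E.Nonempty) : natRk M E = natWeight δ E 𝒢 E := by
  refine (h𝒢.natRk_le_natWeight hδ hM (ground_mem_interClosure hE)).antisymm ?_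
  rcases h𝒢.natRk_lower_bound_or hδ hM subset_rfl hE with h | h
  · have := h𝒢.mul_natWeight_ground hδ hE
    exact Nat.le_of_mul_le_mul_left (c := δ) (by omega) (by omega)
  · exact h

theorem natRk_lower_bound {S : Set α} (hSE : S ⊂ E) (hne : S.Nonempty) :
    δ * S.ncard + 1 ≤ δ * natRk M S + S.ncard := by
  rcases h𝒢.natRk_lower_bound_or hδ hM hSE.subset hne with h | h
  · exact h
  · have h1 := h𝒢.mul_natWeight_ground hδ (hne.mono hSE.subset)
    have h2 := Nat.mul_le_mul_left δ h
    obtain ⟨t, ht⟩ := Nat.exists_eq_add_of_le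
      (Nat.succ_le_of_lt (ncard_lt_ncard hSE h𝒢.finite_ground))
    rw [ht, Nat.succ_eq_add_one, add_assoc, mul_add] at h1
    have h3 : 2 * (1 + t) ≤ δ * (1 + t) := Nat.mul_le_mul_right _ hδ.le
    omega

theorem natRk_of_mem {G : Set α} (hG : G ∈ 𝒢) : natRk M G = natWeight δ E 𝒢 G := by
  refine (h𝒢.natRk_le_natWeight hδ hM (h𝒢.mem_interClosure hδ hG)).antisymm ?_
  have h1 := h𝒢.natRk_lower_bound hδ hM
    ((h𝒢.subset_ground G hG).ssubset_of_ne (h𝒢.ne_ground_of_mem hδ hG)) (h𝒢.nonempty_of_mem hδ hG)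
  have h2 := h𝒢.mul_natWeight_of_mem hδ hG
  exact Nat.le_of_mul_le_mul_left (c := δ) (by omega) (by omega)

theorem natRk_lt_of_partition {A B S : Set α} (hS : S ⊆ E) (hA : A.Nonempty) (hB : B.Nonempty)
    (hd : Disjoint A B) (hAB : A ∪ B = S) :
    δ * S.ncard + 2 ≤ δ * (natRk M A + natRk M B) + S.ncard := by
  have hAS : A ⊂ S := (hAB ▸ subset_union_left : A ⊆ S).ssubset_of_ne
    fun h => by
      obtain ⟨x, hx⟩ := hB
      have : x ∈ S := hAB ▸ Or.inr hx
      exact hd.ne_of_mem (h ▸ this) hx rfl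
  have hBS : B ⊂ S := (hAB ▸ subset_union_right : B ⊆ S).ssubset_of_ne
    fun h => by
      obtain ⟨x, hx⟩ := hA
      have : x ∈ S := hAB ▸ Or.inl hx
      exact hd.ne_of_mem hx (h ▸ this) rfl
  have h1 := h𝒢.natRk_lower_bound hδ hM (hAS.trans_subset hS) hA
  have h2 := h𝒢.natRk_lower_bound hδ hM (hBS.trans_subset hS) hB
  have h3 := ncard_union_eq hd (h𝒢.finite_ground.subset (hAS.subset.trans hS))
    (h𝒢.finite_ground.subset (hBS.subset.trans hS))
  rw [hAB] at h3
  rw [h3, mul_add, mul_add]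
  omega

theorem isConnected : IsConnected M := by
  have hfin := (h𝒢.isSubmodularSystem hδ).finite_matroid hM.1
  refine isConnected_of_lt fun A B hA hB hd hAB => ?_
  rw [hM.1] at hAB ⊢
  have hE : E.Nonempty := hAB ▸ hA.inl
  have h1 := h𝒢.natRk_lt_of_partition hδ hM subset_rfl hA hB hd hAB
  have h2 := h𝒢.mul_natWeight_ground hδ hE
  rw [h𝒢.natRk_ground hδ hM hE]
  exact Nat.lt_of_mul_lt_mul_left (a := δ) (by omega)

theorem isConnected_restrict {G : Set α} (hG : G ∈ 𝒢) : IsConnected (M.restrict G) := by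
  have hGE := h𝒢.subset_ground G hG
  have : (M.restrict G).Finite := ⟨h𝒢.finite_ground.subset hGE⟩
  refine isConnected_of_lt fun A B hA hB hd hAB => ?_
  rw [Matroid.restrict_ground_eq] at hAB ⊢
  have h1 := h𝒢.natRk_lt_of_partition hδ hM hGE hA hB hd hAB
  have h2 := h𝒢.mul_natWeight_of_mem hδ hG
  rw [natRk_restrict subset_rfl, natRk_restrict (hAB ▸ subset_union_left),
    natRk_restrict (hAB ▸ subset_union_right), h𝒢.natRk_of_mem hδ hM hG]
  exact Nat.lt_of_mul_lt_mul_left (a := δ) (by omega)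

theorem isConnected_contract {G : Set α} (hG : G ∈ 𝒢) : IsConnected (M.contract G) := by
  have hfin := (h𝒢.isSubmodularSystem hδ).finite_matroid hM.1
  have hGE := h𝒢.subset_ground G hG
  have hGne := h𝒢.nonempty_of_mem hδ hG
  refine isConnected_of_lt fun A B hA hB hd hAB => ?_
  rw [Matroid.contract_ground, hM.1] at hAB ⊢
  have hAE : A ⊆ E \ G := hAB ▸ subset_union_left
  have hBE : B ⊆ E \ G := hAB ▸ subset_union_right
  have hrk {X : Set α} (hX : X ⊆ E \ G) := natRk_contract (M := M) (S := G) (X := X)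
    (hM.1 ▸ hGE) (hM.1 ▸ hX.trans sdiff_subset) (disjoint_sdiff_left.mono_left hX)
  have h0 := hrk subset_rfl
  have hrA := hrk hAE
  have hrB := hrk hBE
  rw [sdiff_union_of_subset hGE, h𝒢.natRk_ground hδ hM (hGne.mono hGE)] at h0
  rw [h𝒢.natRk_of_mem hδ hM hG] at h0 hrA hrB
  have hproper {X Y : Set α} (hX : X ⊆ E \ G) (hY : Y ⊆ E \ G) (hYne : Y.Nonempty)
      (hXY : Disjoint X Y) : X ∪ G ⊂ E := by
    refine (union_subset (hX.trans sdiff_subset) hGE).ssubset_of_ne fun h => ?_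
    obtain ⟨y, hy⟩ := hYne
    have : y ∈ X ∪ G := h ▸ (hY hy).1
    exact this.elim (fun hyX => hXY.ne_of_mem hyX hy rfl) (hY hy).2
  have hA1 := h𝒢.natRk_lower_bound hδ hM (hproper hAE hBE hB hd) hA.inl
  have hB1 := h𝒢.natRk_lower_bound hδ hM (hproper hBE hAE hA hd.symm) hB.inl
  have hfE {X : Set α} (hX : X ⊆ E \ G) : X.Finite :=
    h𝒢.finite_ground.subset (hX.trans sdiff_subset)
  have hGf := h𝒢.finite_ground.subset hGE
  have hcA := ncard_union_eq (disjoint_sdiff_left.mono_left hAE) (hfE hAE) hGf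
  have hcB := ncard_union_eq (disjoint_sdiff_left.mono_left hBE) (hfE hBE) hGf
  have hcAB := ncard_union_eq hd (hfE hAE) (hfE hBE)
  have hcE := ncard_sdiff_add_ncard_of_subset hGE h𝒢.finite_ground
  rw [hAB] at hcAB
  have hwE := h𝒢.mul_natWeight_ground hδ (hGne.mono hGE)
  have hwG := h𝒢.mul_natWeight_of_mem hδ hG
  rw [hcA] at hA1
  rw [hcB] at hB1
  rw [← hrA] at hA1
  rw [← hrB] at hB1
  rw [← hcE, hcAB, ← h0] at hwE
  simp only [mul_add] at hA1 hB1 hwE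
  refine Nat.lt_of_mul_lt_mul_left (a := δ) ?_
  rw [mul_add]
  omega

theorem isFlat_of_mem {G : Set α} (hG : G ∈ 𝒢) : M.IsFlat G := by
  have hfin := (h𝒢.isSubmodularSystem hδ).finite_matroid hM.1
  have hGE := h𝒢.subset_ground G hG
  rw [Matroid.isFlat_iff_closure_eq]
  refine subset_antisymm (fun e he => ?_) (M.subset_closure G (hM.1 ▸ hGE))
  by_contra heG
  have heE : e ∈ E := hM.1 ▸ M.closure_subset_ground G he
  have hle : natRk M (insert e G) ≤ natRk M G := by
    rw [natRk, natRk, ← M.eRk_closure_eq, Matroid.closure_insert_eq_of_mem_closure he,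
      M.eRk_closure_eq]
  rw [h𝒢.natRk_of_mem hδ hM hG] at hle
  have hcard := ncard_insert_of_notMem heG (h𝒢.finite_ground.subset hGE)
  have hw := h𝒢.mul_natWeight_of_mem hδ hG
  have hle' := Nat.mul_le_mul_left δ hle
  have hsub : insert e G ⊆ E := insert_subset heE hGE
  by_cases hE : insert e G = E
  · have hne : E.Nonempty := ⟨e, heE⟩
    have h1 := h𝒢.mul_natWeight_ground hδ hne
    rw [← h𝒢.natRk_ground hδ hM hne, ← hE, hcard, mul_add] at h1
    omega
  · have h1 := h𝒢.natRk_lower_bound hδ hM (hsub.ssubset_of_ne hE) (insert_nonempty e G)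
    rw [hcard, mul_add] at h1
    omega

theorem isGoodFlat_of_mem {G : Set α} (hG : G ∈ 𝒢) : IsGoodFlat M G where
  isFlat := h𝒢.isFlat_of_mem hδ hM hG
  nonempty := h𝒢.nonempty_of_mem hδ hG
  ne_ground := hM.1 ▸ h𝒢.ne_ground_of_mem hδ hG
  restrict_connected := h𝒢.isConnected_restrict hδ hM hG
  contract_connected := h𝒢.isConnected_contract hδ hM hG

theorem mem_of_isGoodFlat {S : Set α} (hS : IsGoodFlat M S) : S ∈ 𝒢 := by
  classical
  have hfin := (h𝒢.isSubmodularSystem hδ).finite_matroid hM.1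
  obtain ⟨hSL, hSrk⟩ := (h𝒢.isSubmodularSystem hδ).mem_of_isFlat_of_isConnected hM.1 hM.2
    hS.isFlat hS.nonempty hS.restrict_connected
  have hSE := subset_of_mem_interClosure hSL
  have hSne : S ≠ E := hM.1 ▸ hS.ne_ground
  obtain ⟨P, hP, hPc, hPS, hPd⟩ := h𝒢.exists_disjoint_interCount hSL
  have hpos := interCount_pos h𝒢.subset_ground hSL hSne
  obtain ⟨A, hA⟩ : P.Nonempty := Finset.card_pos.1 (by omega)
  let B : Set α := ⋃ C ∈ P.erase A, C
  have hAB : A ∪ B = E \ S := by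
    rw [← hPS]
    conv_rhs => rw [← Finset.insert_erase hA]
    rw [Finset.set_biUnion_insert]
  have hd : Disjoint A B := by
    rw [disjoint_iUnion₂_right]
    exact fun C hC => hPd hA (Finset.mem_of_mem_erase hC) (Finset.ne_of_mem_erase hC).symm
  have hAs : A ⊆ E \ S := hAB ▸ subset_union_left
  have hBs : B ⊆ E \ S := hAB ▸ subset_union_right
  by_cases hBne : B.Nonempty
  swap
  · rw [not_nonempty_iff_eq_empty] at hBne
    rw [hBne, union_empty] at hAB
    have := (hP A hA).2
    rwa [hAB, sdiff_sdiff_cancel_left hSE] at this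
  exfalso
  have hlt := hS.contract_connected.lt (h𝒢.co_nonempty hδ (hP A hA)) hBne hd
    (by rw [hAB, Matroid.contract_ground, hM.1])
  rw [Matroid.contract_ground, hM.1] at hlt
  have hrk {X : Set α} (hX : X ⊆ E \ S) := natRk_contract (M := M) (S := S) (X := X)
    (hM.1 ▸ hSE) (hM.1 ▸ hX.trans sdiff_subset) (disjoint_sdiff_left.mono_left hX)
  have hEne := hS.nonempty.mono hSE
  have h0 := hrk subset_rfl
  have hrA := hrk hAs
  have hrB := hrk hBs
  rw [sdiff_union_of_subset hSE, h𝒢.natRk_ground hδ hM hEne] at h0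
  rw [hSrk] at h0 hrA hrB
  have hcompl {X Y : Set α} (hX : X ⊆ E \ S) (hXY : Disjoint X Y) (h : X ∪ Y = E \ S) :
      E \ (X ∪ S) = Y := by
    rw [union_comm, ← sdiff_sdiff, ← h, union_sdiff_cancel_left hXY.inter_eq.subset]
  have hcA : IsCoUnion E 𝒢 (interCount E 𝒢 S - 1) (E \ (A ∪ S)) := by
    rw [hcompl hAs hd hAB]
    exact ⟨P.erase A, fun C hC => hP C (Finset.mem_of_mem_erase hC),
      by rw [Finset.card_erase_of_mem hA, hPc], rfl⟩
  have hcB : IsCoUnion E 𝒢 1 (E \ (B ∪ S)) := by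
    rw [hcompl hBs hd.symm (union_comm A B ▸ hAB)]
    exact (hP A hA).isCoUnion
  have hASE : A ∪ S ⊆ E := union_subset (hAs.trans sdiff_subset) hSE
  have hBSE : B ∪ S ⊆ E := union_subset (hBs.trans sdiff_subset) hSE
  have hASL := mem_interClosure_of_isCoUnion hASE hS.nonempty.inr hcA
  have hBSL := mem_interClosure_of_isCoUnion hBSE hS.nonempty.inr hcB
  have hleA := Nat.mul_le_mul_left δ (h𝒢.natRk_le_natWeight hδ hM hASL)
  have hleB := Nat.mul_le_mul_left δ (h𝒢.natRk_le_natWeight hδ hM hBSL)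
  have hwA := h𝒢.mul_natWeight hδ hASL
  have hwB := h𝒢.mul_natWeight hδ hBSL
  have hwS := h𝒢.mul_natWeight hδ hSL
  have hwE := h𝒢.mul_natWeight_ground hδ hEne
  have hiA := interCount_le hASE hcA
  have hiB := interCount_le hBSE hcB
  have hfE {X : Set α} (hX : X ⊆ E \ S) : X.Finite :=
    h𝒢.finite_ground.subset (hX.trans sdiff_subset)
  have hSf := h𝒢.finite_ground.subset hSE
  have hkA := ncard_union_eq (disjoint_sdiff_left.mono_left hAs) (hfE hAs) hSf
  have hkB := ncard_union_eq (disjoint_sdiff_left.mono_left hBs) (hfE hBs) hSf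
  have hkAB := ncard_union_eq hd (hfE hAs) (hfE hBs)
  have hkE := ncard_sdiff_add_ncard_of_subset hSE h𝒢.finite_ground
  rw [hAB] at hkAB
  rw [← hrA] at hleA
  rw [← hrB] at hleB
  rw [← hkE, hkAB, ← h0] at hwE
  rw [hkA] at hwA
  rw [hkB] at hwB
  have hlt' := Nat.mul_lt_mul_of_pos_left hlt (show 0 < δ by omega)
  simp only [mul_add] at hleA hleB hwA hwB hwE hlt'
  omega

theorem rank_mem {G : Set α} (hG : G ∈ 𝒢) : ∃ g : ℕ, g ≡ 1 [ZMOD (δ : ℤ) - 1] ∧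
    ((δ : ℤ) - 1) * (G.ncard : ℤ) = (δ : ℤ) * g - 1 ∧ M.eRk G = g := by
  have hfin := (h𝒢.isSubmodularSystem hδ).finite_matroid hM.1
  obtain ⟨g, hg1, hg⟩ := h𝒢.card_mem G hG
  have hw : (δ : ℤ) * natRk M G + G.ncard = δ * G.ncard + 1 := by
    rw [h𝒢.natRk_of_mem hδ hM hG]
    exact_mod_cast h𝒢.mul_natWeight_of_mem hδ hG
  have hgw : g = natRk M G :=
    mul_left_cancel₀ (show (δ : ℤ) ≠ 0 by positivity) (by linear_combination -hg - hw)
  subst hgw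
  exact ⟨natRk M G, hg1, hg, (natRk_cast G).symm⟩

theorem rank_ground : ∃ g₀ : ℕ, g₀ ≡ 0 [ZMOD (δ : ℤ) - 1] ∧
    ((δ : ℤ) - 1) * (E.ncard : ℤ) = (δ : ℤ) * g₀ ∧ M.eRk E = g₀ := by
  have hfin := (h𝒢.isSubmodularSystem hδ).finite_matroid hM.1
  obtain ⟨g, hg1, hg⟩ := h𝒢.card_ground
  have hw : (δ : ℤ) * natRk M E + E.ncard = δ * E.ncard := by
    rcases E.eq_empty_or_nonempty with hE | hE
    · simp [hE, natRk]
    · rw [h𝒢.natRk_ground hδ hM hE]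
      exact_mod_cast h𝒢.mul_natWeight_ground hδ hE
  have hgw : g = natRk M E :=
    mul_left_cancel₀ (show (δ : ℤ) ≠ 0 by positivity) (by linear_combination -hg - hw)
  subst hgw
  exact ⟨natRk M E, hg1, hg, (natRk_cast E).symm⟩

end IsGFamily

end

end GMatroid

theorem mainTheorem6 {α : Type*} (δ : ℕ) (hδ : 2 < δ) (E : Set α) (𝒢 : Set (Set α))
    (h𝒢 : GMatroid.IsGFamily δ E 𝒢) :
    (∃! M : Matroid α, GMatroid.IsGMatroid δ E 𝒢 M) ∧
    ∀ M : Matroid α, GMatroid.IsGMatroid δ E 𝒢 M →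
      GMatroid.IsConnected M ∧
      {G | GMatroid.IsGoodFlat M G} = 𝒢 ∧
      (∀ G ∈ 𝒢, ∃ g : ℕ, g ≡ 1 [ZMOD (δ : ℤ) - 1] ∧
        ((δ : ℤ) - 1) * (G.ncard : ℤ) = (δ : ℤ) * g - 1 ∧ M.eRk G = g) ∧
      (∃ g₀ : ℕ, g₀ ≡ 0 [ZMOD (δ : ℤ) - 1] ∧
        ((δ : ℤ) - 1) * (E.ncard : ℤ) = (δ : ℤ) * g₀ ∧ M.eRk E = g₀) := by
  obtain ⟨M₀, hM₀, hind⟩ := h𝒢.exists_isGMatroid hδ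
  refine ⟨⟨M₀, hM₀, fun M hM => GMatroid.IsGFamily.isGMatroid_unique hM hM₀⟩, fun M hM => ?_⟩
  obtain rfl := GMatroid.IsGFamily.isGMatroid_unique hM hM₀
  have hW : GMatroid.IsWeightMatroid δ E 𝒢 M := ⟨hM.1, hind⟩
  exact ⟨h𝒢.isConnected hδ hW,
    Set.ext fun G => ⟨h𝒢.mem_of_isGoodFlat hδ hW, h𝒢.isGoodFlat_of_mem hδ hW⟩,
    fun G hG => h𝒢.rank_mem hδ hW hG, h𝒢.rank_ground hδ hW⟩
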